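/- **Conventions.** Computability is that of Type-2 computability on Baire space $\mathbb N^{\mathbb N}$: a partial function $F:\subseteq\mathbb N^{\mathbb N}\to\mathbb N^{\mathbb N}$ is computable if it is computed by a Turing machine with infinite input and one-way infinite output. For representations $\delta:\subseteq\mathbb N^{\mathbb N}\to A$ and $\delta':\subseteq\mathbb N^{\mathbb N}\to B$, a partial multi-valued operation $f:\subseteq A\rightrightarrows B$ is $(\delta,\delta')$-computable if there is a computable $F$ such that for every $p\in\operatorname{dom}\delta$ with $\delta(p)\in\operatorname{dom}f$, $F(p)$ is defined and $\delta'(F(p))$ is defined and belongs to $f(\delta(p))$. A computable metric space $(X,d,\nu)$ is a metric space $(X,d)$ with a dense sequence $\nu:\mathbb N\to X$ such that the reals $d(\nu(a),\nu(b))$ are computable uniformly in $a,b$. With standard numberings of pairs and of positive rationals, let $\alpha\langle a,r\rangle$ be the open ball with centre $\nu(a)$ and the $r$-th positive rational as radius. The open sets $\Sigma^0_1(X)$ are represented by $\delta_{\Sigma^0_1}(p)=\bigcup\{\alpha(p_i-1):i\in\mathbb N,\ p_i\ge 1\}$ and the closed sets $\Pi^0_1(X)$ by $\delta_{\Pi^0_1}(p)=X\setminus\delta_{\Sigma^0_1}(p)$.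 For a representation $\delta$ of $A$, the set $A^*$ of finite words over $A$ is represented by $\delta^*(n.\langle p^{(0)},p^{(1)},\dots\rangle)=\delta(p^{(0)})\dots\delta(p^{(n-1)})$, where $\langle p^{(0)},p^{(1)},\dots\rangle(\langle i,j\rangle)=p^{(i)}_j$. The order of a family $(A_i)_{i\in I}$ of subsets of $X$ is the least $n$ such that $\bigcap_{j\le n}A_{i_j}=\emptyset$ for all distinct $i_0,\dots,i_n\in I$. **Proposition.** Let $(X,d,\nu)$ be a computable metric space. 1. The operation $S_-:\subseteq\Sigma^0_1(X)^*\rightrightarrows\Pi^0_1(X)^*$ with domain $\{(U_i)_{i<k}:\bigcup_iU_i=X\}$ and $$S_-((U_i)_{i<k})=\Big\{(F_i)_{i<k}:(\forall i)\,F_i\subseteq U_i,\ \bigcup_iF_i=X\Big\}$$ is $(\delta_{\Sigma^0_1}^*,\delta_{\Pi^0_1}^*)$-computable. 2. The operation $T:\subseteq\Pi^0_1(X)^*\rightrightarrows\Sigma^0_1(X)^*$ with domain $\{(B_i)_{i<k}:\bigcap_iB_i=\emptyset\}$ and $$T((B_i)_{i<k})=\Big\{(U_i)_{i<k}:\bigcap_iU_i=\emptyset,\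 (\forall i)\,B_i\subseteq U_i\Big\}$$ is $(\delta_{\Pi^0_1}^*,\delta_{\Sigma^0_1}^*)$-computable. 3. For every $N\in\mathbb N$, the operation $S_{+,N}:\subseteq\Pi^0_1(X)^*\rightrightarrows\Sigma^0_1(X)^*$ whose domain is the set of $(F_i)_{i<k}$ of order at most $N+1$, with $$S_{+,N}((F_i)_{i<k})=\{(U_i)_{i<k}:(\forall i)\,F_i\subseteq U_i,\ (U_i)_{i<k}\text{ has order at most }N+1\},$$ is $(\delta_{\Pi^0_1}^*,\delta_{\Sigma^0_1}^*)$-computable. -/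

import Mathlib

open Set TopologicalSpace

namespace TTE

/-! ### Computability on Baire space -/

/-- Baire space, the set of all sequences of natural numbers. -/
abbrev Baire : Type := ℕ → ℕ

/-- The prefix `p 0, …, p (n - 1)` of length `n` of a sequence. -/
def initial (p : Baire) (n : ℕ) : List ℕ := (List.range n).map p

/-- A partial function `F` on Baire space is computable if it is the limit of a computable function
on finite words that is monotone for the prefix order: `F p` is the sequence `q` approximated by the
words `g (initial p m)`, and `F p` is undefined if these words do not grow to an infinite sequence.
This is computability by a Turing machine that reads the infinite sequence `p` and
writes the infinite sequence `F p` on a one-way output tape. -/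
def ComputableFun (F : Baire →. Baire) : Prop :=
  ∃ g : List ℕ → List ℕ, Computable g ∧ (∀ u v, u <+: v → g u <+: g v) ∧
    ∀ p q : Baire, q ∈ F p ↔ ∀ n, ∃ m, initial q n <+: g (initial p m)

/-! ### Representations and multi-valued operations

A representation of `A` is a (surjective) partial function `δ : Baire →. A`; a sequence `p` with
`a ∈ δ p` is a `δ`-name of `a`. -/

/-- A partial multi-valued operation from `A` to `B`: a domain and, for every argument in the domain,
the set of admissible values. -/
structure MultiMap (A B : Type*) where
  dom : Set A
  val : A → Set B

/-- `F` maps every `δ`-name of an `a` in the domain of `f` to a `δ'`-name of some value in `f a`. -/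
def IsRealiser {A B : Type*} (δ : Baire →. A) (δ' : Baire →. B) (F : Baire →. Baire)
    (f : MultiMap A B) : Prop :=
  ∀ p : Baire, ∀ a ∈ δ p, a ∈ f.dom → ∃ q ∈ F p, ∃ b ∈ δ' q, b ∈ f.val a

/-- `f` is `(δ, δ')`-computable. -/
def MultiMap.IsComputable {A B : Type*} (f : MultiMap A B) (δ : Baire →. A) (δ' : Baire →. B) :
    Prop :=
  ∃ F : Baire →. Baire, ComputableFun F ∧ IsRealiser δ δ' F f

/-- Finite words `(a i)_{i < k}` of any length over `A`. -/
abbrev Word (A : Type*) : Type _ := Σ k : ℕ, Fin k → A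

/-- For `p = n.⟨p⁽⁰⁾, p⁽¹⁾, …⟩` this is `p⁽ⁱ⁾`. -/
def component (p : Baire) (i : ℕ) : Baire := fun j => p (Nat.pair i j + 1)

/-- The representation `δ*` of finite words: a name `n.⟨p⁽⁰⁾, p⁽¹⁾, …⟩` names the word of length `n`
with letters `δ p⁽⁰⁾, …, δ p⁽ⁿ⁻¹⁾`. -/
def starRep {A : Type*} (δ : Baire →. A) : Baire →. Word A := fun p =>
  ⟨∀ i : Fin (p 0), (δ (component p i)).Dom,
    fun h => ⟨p 0, fun i => (δ (component p i)).get (h i)⟩⟩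

/-! ### Computable metric spaces -/

/-- A standard total numbering of the rationals, `⟨⟨i, j⟩, k⟩ ↦ (i - j) / (k + 1)`. -/
def nuQ (n : ℕ) : ℚ :=
  ((n.unpair.1.unpair.1 : ℚ) - (n.unpair.1.unpair.2 : ℚ)) / ((n.unpair.2 : ℚ) + 1)

/-- A standard total numbering of the positive rationals, `⟨i, j⟩ ↦ (i + 1) / (j + 1)`. -/
def nuQPos (n : ℕ) : ℚ := ((n.unpair.1 : ℚ) + 1) / ((n.unpair.2 : ℚ) + 1)

section Metric

variable {X : Type*} [MetricSpace X]

/-- `(X, d, ν)` is a computable metric space: `ν` is a dense sequence and the real numbers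
`d (ν a) (ν b)` are computable uniformly in `a` and `b`. -/
structure IsComputableMetricSpace (ν : ℕ → X) : Prop where
  dense : DenseRange ν
  dist_computable : ∃ f : ℕ × ℕ × ℕ → ℕ, Computable f ∧
    ∀ a b n, |dist (ν a) (ν b) - (nuQ (f (a, b, n)) : ℝ)| ≤ (1 / 2 : ℝ) ^ n

/-- The numbering `⟨a, r⟩ ↦ B(ν a, r)` of the ideal open balls. -/
def idealBall (ν : ℕ → X) (n : ℕ) : Opens X :=
  ⟨Metric.ball (ν n.unpair.1) (nuQPos n.unpair.2 : ℝ), Metric.isOpen_ball⟩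

/-- The open set `⋃ {idealBall (p i - 1) | p i ≥ 1}` listed by `p`. -/
def openOf (ν : ℕ → X) (p : Baire) : Opens X :=
  ⨆ (i : ℕ) (_ : 1 ≤ p i), idealBall ν (p i - 1)

/-- The (total) representation `δ_{Σ⁰₁}` of the open sets of `X`. -/
def deltaSigma (ν : ℕ → X) : Baire →. Opens X := fun p => Part.some (openOf ν p)

/-- The (total) representation `δ_{Π⁰₁}` of the closed sets of `X`, by complements of open sets. -/
def deltaPi (ν : ℕ → X) : Baire →. Closeds X := fun p => Part.some (openOf ν p).compl

end Metric

/-! ### The operations -/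

/-- The order of a family of sets: the least `n` such that `A (i 0) ∩ … ∩ A (i n) = ∅` whenever
`i 0, …, i n` are distinct indices (`⊤` if there is none, which is impossible for finite families). -/
noncomputable def order {X ι : Type*} (A : ι → Set X) : ℕ∞ :=
  sInf ((fun n : ℕ => (n : ℕ∞)) ''
    {n : ℕ | ∀ i : Fin (n + 1) → ι, Function.Injective i → ⋂ j, A (i j) = ∅})

/-- `S₋`: closed shrinkings of finite open covers. -/
def closedShrinking (X : Type*) [TopologicalSpace X] :
    MultiMap (Word (Opens X)) (Word (Closeds X)) where
  dom := {U | ⋃ i, (U.2 i : Set X) = univ}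
  val U := Sigma.mk U.1 '' {F : Fin U.1 → Closeds X |
    (∀ i, (F i : Set X) ⊆ U.2 i) ∧ ⋃ i, (F i : Set X) = univ}

/-- `T`: open swellings with empty intersection of finite closed families with empty
intersection. -/
def openSwelling (X : Type*) [TopologicalSpace X] :
    MultiMap (Word (Closeds X)) (Word (Opens X)) where
  dom := {B | ⋂ i, (B.2 i : Set X) = ∅}
  val B := Sigma.mk B.1 '' {U : Fin B.1 → Opens X |
    ⋂ i, (U i : Set X) = ∅ ∧ ∀ i, (B.2 i : Set X) ⊆ U i}

/-- `S_{+,N}`: open swellings of order at most `N + 1` of finite closed families of order at most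
`N + 1`. -/
def openSwellingOfOrder (X : Type*) [TopologicalSpace X] (N : ℕ) :
    MultiMap (Word (Closeds X)) (Word (Opens X)) where
  dom := {F | order (fun i => (F.2 i : Set X)) ≤ (N : ℕ∞) + 1}
  val F := Sigma.mk F.1 '' {U : Fin F.1 → Opens X |
    (∀ i, (F.2 i : Set X) ⊆ U i) ∧ order (fun i => (U i : Set X)) ≤ (N : ℕ∞) + 1}

end TTE

namespace TTE

open Filter

/-! ### Primitive recursion and semi-decidability -/

section Recursion

variable {α β : Type*} [Primcodable α] [Primcodable β]

/-! All three operations come from one construction, `exists_computableFun_complementary`. From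
names of open `U i`, `i < k`, it lists open `V i` such that no point lies in more than `m` of them,
while `V i` contains each point outside `U i` that lies in at least `k - m` of the `U j`. For parts
1 and 2 take `m = k - 1`; part 1 then outputs the complements of the `V i`. For part 3 take `m = N +
1`. Closed inputs are named by their complements, which serve as the `U i`.

A ball enters `V i` at precision `t` when it is `Far`, up to `1 / (t + 1)`, from the first `t` balls
of `U i`, and `Near`, with that margin, to one of the first `t` balls of `U j` for all but at most
`m` indices `j`. If more than `m` sets `V i` shared a point, the certificate of least precision
would be `Near` a ball of some `U j` with `j` among those indices, which the finer certificate of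
`j` forbids (`exists_notMem_output`). Conversely, a large `t` and a tiny ball certify every required
point (`mem_output`). Both ball relations are semi-decidable, so a search over time bounds makes the
listing computable. -/

theorem primrecPred_forall_lt {R : ℕ → α → Prop} (hR : PrimrecRel R) {g : α → ℕ} (hg : Primrec g) :
    PrimrecPred fun x => ∀ n < g x, R n x :=
  ((PrimrecRel.forall_mem_list hR).comp (Primrec.list_range.comp hg) Primrec.id).of_eq
    fun x => by simp

theorem primrecPred_exists_lt {R : ℕ → α → Prop} (hR : PrimrecRel R) {g : α → ℕ} (hg : Primrec g) :
    PrimrecPred fun x => ∃ n < g x, R n x :=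
  ((PrimrecRel.exists_mem_list hR).comp (Primrec.list_range.comp hg) Primrec.id).of_eq
    fun x => by simp

theorem primrec_card_filter_range {R : ℕ → α → Prop} [DecidableRel R] (hR : PrimrecRel R) {g : α → ℕ}
    (hg : Primrec g) : Primrec fun x => ((Finset.range (g x)).filter fun n => R n x).card :=
  (Primrec.list_length.comp ((PrimrecRel.listFilter hR).comp (Primrec.list_range.comp hg)
    Primrec.id)).of_eq fun x => by
      rw [← List.toFinset_card_of_nodup ((List.nodup_range).filter _), List.toFinset_filter,
        List.toFinset_range]
      simp

/-- Existential quantification over `ℕ` turns a decidable predicate into a semi-decidable one. -/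
theorem rePred_exists {S : α × ℕ × ℕ → Prop} (hS : PrimrecPred S) {f : α × ℕ → ℕ}
    (hf : Computable f) : REPred fun x => ∃ n, S (x, n, f (x, n)) := by
  classical
  have hd : Computable fun y : α × ℕ => decide (S (y.1, y.2, f y)) :=
    hS.decide.to_comp.comp (Computable.fst.pair (Computable.snd.pair hf))
  have := (Partrec.rfind (p := fun x n => Part.some (decide (S (x, n, f (x, n)))))
    (Computable.partrec hd)).dom_re
  exact this.of_eq fun x => Nat.rfind_dom.trans (by simp)

/-- A semi-decidable predicate is the limit of an increasing primitive recursive sequence of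
predicates. -/
theorem exists_primrecRel_of_rePred {P : α → Prop} (hP : REPred P) :
    ∃ R : ℕ → α → Prop, PrimrecRel R ∧ (∀ s a, R s a → P a) ∧
      ∀ a, P a → ∀ᶠ s in atTop, R s a := by
  obtain ⟨c, hc⟩ := Nat.Partrec.Code.exists_code.1 hP
  have key : ∀ a, P a ↔ ∃ y, y ∈ Nat.Partrec.Code.eval c (Encodable.encode a) := by
    intro a
    rw [hc]
    simp [Part.assert]
  -- Run a code for `P` with fuel `s`: `evaln` is primitive recursive and monotone in the fuel.
  refine ⟨fun s a => (Nat.Partrec.Code.evaln s c (Encodable.encode a)).isSome = true, ?_, ?_, ?_⟩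
  · have : Primrec fun x : ℕ × α =>
        (Nat.Partrec.Code.evaln x.1 c (Encodable.encode x.2)).isSome :=
      Primrec.option_isSome.comp (Nat.Partrec.Code.primrec_evaln.comp
        ((Primrec.fst.pair (Primrec.const c)).pair (Primrec.encode.comp Primrec.snd)))
    exact Primrec.eq.comp this (Primrec.const true)
  · intro s a h
    obtain ⟨y, hy⟩ := Option.isSome_iff_exists.1 h
    exact (key a).2 ⟨y, Nat.Partrec.Code.evaln_sound hy⟩
  · intro a h
    obtain ⟨y, hy⟩ := (key a).1 h
    obtain ⟨s₀, hs⟩ := Nat.Partrec.Code.evaln_complete.1 hy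
    filter_upwards [eventually_ge_atTop s₀] with s hle
    exact Option.isSome_iff_exists.2 ⟨y, Nat.Partrec.Code.evaln_mono hle hs⟩

/-- Functions whose values are rational numbers with primitive recursive numerators (given as
differences) and denominators. -/
def PrimrecRat (φ : α → ℝ) : Prop :=
  ∃ a b d : α → ℕ, Primrec a ∧ Primrec b ∧ Primrec d ∧
    ∀ x, φ x = ((a x : ℝ) - b x) / ((d x : ℝ) + 1)

theorem PrimrecRat.add {φ ψ : α → ℝ} (hφ : PrimrecRat φ) (hψ : PrimrecRat ψ) :
    PrimrecRat fun x => φ x + ψ x := by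
  obtain ⟨a, b, d, ha, hb, hd, h⟩ := hφ
  obtain ⟨a', b', d', ha', hb', hd', h'⟩ := hψ
  have mul {f g : α → ℕ} (hf : Primrec f) (hg : Primrec g) : Primrec fun x => f x * g x :=
    Primrec.nat_mul.comp hf hg
  have add {f g : α → ℕ} (hf : Primrec f) (hg : Primrec g) : Primrec fun x => f x + g x :=
    Primrec.nat_add.comp hf hg
  have s := Primrec.succ.comp hd
  have s' := Primrec.succ.comp hd'
  -- The denominator is stored minus one: `(d + 1) * (d' + 1) - 1 = d * d' + d + d'`.
  refine ⟨_, _, _, add (mul ha s') (mul ha' s), add (mul hb s') (mul hb' s),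
    add (add (mul hd hd') hd) hd', fun x => ?_⟩
  show φ x + ψ x = _
  rw [h, h', div_add_div _ _ (by positivity) (by positivity)]
  push_cast
  congr 1 <;> ring

theorem PrimrecRat.lt {φ ψ : α → ℝ} (hφ : PrimrecRat φ) (hψ : PrimrecRat ψ) :
    PrimrecPred fun x => φ x < ψ x := by
  obtain ⟨a, b, d, ha, hb, hd, h⟩ := hφ
  obtain ⟨a', b', d', ha', hb', hd', h'⟩ := hψ
  have mul {f g : α → ℕ} (hf : Primrec f) (hg : Primrec g) : Primrec fun x => f x * g x :=
    Primrec.nat_mul.comp hf hg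
  have add {f g : α → ℕ} (hf : Primrec f) (hg : Primrec g) : Primrec fun x => f x + g x :=
    Primrec.nat_add.comp hf hg
  have s := Primrec.succ.comp hd
  have s' := Primrec.succ.comp hd'
  refine (Primrec.nat_lt.comp (add (mul ha s') (mul hb' s)) (add (mul ha' s) (mul hb s'))).of_eq
    fun x => ?_
  rw [h, h', div_lt_div_iff₀ (by positivity) (by positivity), ← Nat.cast_lt (α := ℝ)]
  push_cast
  constructor <;> intro h <;> linarith

theorem PrimrecRat.comp {φ : β → ℝ} (hφ : PrimrecRat φ) {f : α → β} (hf : Primrec f) :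
    PrimrecRat fun x => φ (f x) := by
  obtain ⟨a, b, d, ha, hb, hd, h⟩ := hφ
  exact ⟨_, _, _, ha.comp hf, hb.comp hf, hd.comp hf, fun x => h (f x)⟩

theorem primrecRat_nuQ : PrimrecRat fun n => (nuQ n : ℝ) := by
  have u := Primrec.unpair
  refine ⟨fun n => n.unpair.1.unpair.1, fun n => n.unpair.1.unpair.2, fun n => n.unpair.2,
    Primrec.fst.comp (u.comp (Primrec.fst.comp u)), Primrec.snd.comp (u.comp (Primrec.fst.comp u)),
    Primrec.snd.comp u, fun n => ?_⟩
  simp [nuQ]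

theorem primrecRat_nuQPos : PrimrecRat fun n => (nuQPos n : ℝ) := by
  have u := Primrec.unpair
  refine ⟨fun n => n.unpair.1 + 1, fun _ => 0, fun n => n.unpair.2,
    Primrec.succ.comp (Primrec.fst.comp u), Primrec.const 0, Primrec.snd.comp u, fun n => ?_⟩
  simp [nuQPos]

theorem primrecRat_one_div_succ : PrimrecRat fun n : ℕ => 1 / ((n : ℝ) + 1) :=
  ⟨fun _ => 1, fun _ => 0, id, Primrec.const 1, Primrec.const 0, Primrec.id, fun n => by simp⟩

theorem primrecRat_half_pow : PrimrecRat fun n : ℕ => (1 / 2 : ℝ) ^ n := by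
  have hpow : Primrec fun n : ℕ => 2 ^ n :=
    (Primrec₂.unpaired'.1 Nat.Primrec.pow).comp (Primrec.const 2) Primrec.id
  refine ⟨fun _ => 1, fun _ => 0, fun n => 2 ^ n - 1, Primrec.const 1, Primrec.const 0,
    Primrec.pred.comp hpow, fun n => ?_⟩
  have : 1 ≤ 2 ^ n := Nat.one_le_two_pow
  push_cast [this]
  simp

end Recursion

/-! ### Functionals given by a computable function on words -/

theorem initial_take (p : Baire) {n m : ℕ} (h : n ≤ m) : (initial p m).take n = initial p n := by
  simp [initial, ← List.map_take, List.take_range, h]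

@[simp] theorem length_initial (p : Baire) (n : ℕ) : (initial p n).length = n := by
  simp [initial]

theorem getD_initial (p : Baire) {n j : ℕ} (h : j < n) : (initial p n).getD j 0 = p j := by
  simp [initial, List.getD, h]

theorem getD_initial_of_le (p : Baire) {n j : ℕ} (h : n ≤ j) : (initial p n).getD j 0 = 0 := by
  simp [initial, List.getD, h]

/-- One letter is written per letter read, so the outputs on prefixes are nested and exhaust the
sequence. -/
theorem computableFun_of_primrec {h : List ℕ → ℕ} (hh : Primrec h) :
    ComputableFun fun p => Part.some fun e => h (initial p (e + 1)) := by
  set g : List ℕ → List ℕ := fun u => (List.range u.length).map fun e => h (u.take (e + 1)) with hg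
  have hgi : ∀ (p : Baire) m, g (initial p m) = initial (fun e => h (initial p (e + 1))) m := by
    intro p m
    simp only [hg, length_initial]
    rw [initial]
    refine List.map_congr_left fun e he => ?_
    exact congrArg h (initial_take p (Nat.succ_le_of_lt (List.mem_range.1 he)))
  refine ⟨g, ?_, ?_, ?_⟩
  · exact (Primrec.list_map (Primrec.list_range.comp Primrec.list_length)
      (hh.comp (Primrec.list_take.comp (Primrec.succ.comp Primrec.snd) Primrec.fst)).to₂).to_comp
  · rintro u _ ⟨w, rfl⟩
    rw [List.prefix_iff_eq_take]
    simp only [hg, List.length_map, List.length_range, ← List.map_take, List.take_range,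
      List.length_append, Nat.le_add_right, min_eq_left]
    refine List.map_congr_left fun e he => ?_
    rw [List.take_append_of_le_length (by simpa using he)]
  · intro p q
    simp only [Part.mem_some_iff, hgi]
    constructor
    · rintro rfl n
      exact ⟨n, List.prefix_rfl⟩
    · intro H
      funext e
      obtain ⟨m, hm⟩ := H (e + 1)
      have hlen : e < m := by simpa using hm.length_le
      have h1 := hm.getElem (i := e) (by simp)
      simpa [initial] using h1

/-! ### Comparing balls -/

section Metric

variable {X : Type*} [MetricSpace X]

/-- The ideal ball coded by `z` lies inside the ball listed by the letter `w`, with a margin of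
more than `1 / (t + 1)`. -/
def Near (ν : ℕ → X) (z w t : ℕ) : Prop :=
  w ≠ 0 ∧ dist (ν z.unpair.1) (ν (w - 1).unpair.1) + (nuQPos z.unpair.2 + 1 / ((t : ℝ) + 1)) <
    nuQPos (w - 1).unpair.2

/-- The ideal ball coded by `z` avoids the ball listed by the letter `w` when the radius of the
latter is diminished by `1 / (t + 1)`. -/
def Far (ν : ℕ → X) (z w t : ℕ) : Prop :=
  w = 0 ∨ nuQPos (w - 1).unpair.2 + nuQPos z.unpair.2 <
    dist (ν z.unpair.1) (ν (w - 1).unpair.1) + 1 / ((t : ℝ) + 1)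

/-- A strict inequality between reals is witnessed by a single approximation whose error is below
half the gap; this is what makes `Near` semi-decidable. -/
theorem add_lt_iff_exists_approx {d c r : ℝ} {v : ℕ → ℝ} (hv : ∀ n, |d - v n| ≤ (1 / 2 : ℝ) ^ n) :
    d + c < r ↔ ∃ n, v n + ((1 / 2 : ℝ) ^ n + c) < r := by
  constructor
  · intro h
    obtain ⟨n, hn⟩ := exists_pow_lt_of_lt_one (show (0 : ℝ) < (r - (d + c)) / 2 by linarith)
      (show (1 / 2 : ℝ) < 1 by norm_num)
    exact ⟨n, by linarith [(abs_le.1 (hv n)).1]⟩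
  · rintro ⟨n, hn⟩
    linarith [(abs_le.1 (hv n)).2]

theorem lt_add_iff_exists_approx {d c r : ℝ} {v : ℕ → ℝ} (hv : ∀ n, |d - v n| ≤ (1 / 2 : ℝ) ^ n) :
    r < d + c ↔ ∃ n, r + (1 / 2 : ℝ) ^ n < v n + c := by
  constructor
  · intro h
    obtain ⟨n, hn⟩ := exists_pow_lt_of_lt_one (show (0 : ℝ) < (d + c - r) / 2 by linarith)
      (show (1 / 2 : ℝ) < 1 by norm_num)
    exact ⟨n, by linarith [(abs_le.1 (hv n)).2]⟩
  · rintro ⟨n, hn⟩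
    linarith [(abs_le.1 (hv n)).1]

/-! ### Semi-decidability of the ball relations -/

section Codes

open Primrec

theorem primrec_center : Primrec fun z : ℕ => z.unpair.1 := fst.comp unpair

theorem primrec_radius : Primrec fun z : ℕ => z.unpair.2 := snd.comp unpair

theorem computable_dist_approx {f : ℕ × ℕ × ℕ → ℕ} (hf : Computable f) :
    Computable fun y : (ℕ × ℕ × ℕ) × ℕ =>
      f (y.1.1.unpair.1, (y.1.2.1 - 1).unpair.1, y.2) :=
  hf.comp (((primrec_center.comp (fst.comp fst)).pair
    ((primrec_center.comp (pred.comp (fst.comp (snd.comp fst)))).pair snd)).to_comp)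

theorem rePred_near {ν : ℕ → X} (hν : IsComputableMetricSpace ν) :
    REPred fun x : ℕ × ℕ × ℕ => Near ν x.1 x.2.1 x.2.2 := by
  obtain ⟨f, hf, hd⟩ := hν.dist_computable
  have hz : Primrec fun y : (ℕ × ℕ × ℕ) × ℕ × ℕ => y.1.1 := fst.comp fst
  have hw : Primrec fun y : (ℕ × ℕ × ℕ) × ℕ × ℕ => y.1.2.1 := fst.comp (snd.comp fst)
  have ht : Primrec fun y : (ℕ × ℕ × ℕ) × ℕ × ℕ => y.1.2.2 := snd.comp (snd.comp fst)
  refine (rePred_exists (PrimrecPred.and (PrimrecPred.not (Primrec.eq.comp hw (const 0)))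
    (PrimrecRat.lt (((primrecRat_nuQ.comp (snd.comp snd))).add
      ((primrecRat_half_pow.comp (fst.comp snd)).add
        ((primrecRat_nuQPos.comp (primrec_radius.comp hz)).add (primrecRat_one_div_succ.comp ht))))
      (primrecRat_nuQPos.comp (primrec_radius.comp (pred.comp hw)))))
    (computable_dist_approx hf)).of_eq fun x => ?_
  rw [Near, add_lt_iff_exists_approx (hd _ _), ← exists_and_left]
  rfl

theorem rePred_far {ν : ℕ → X} (hν : IsComputableMetricSpace ν) :
    REPred fun x : ℕ × ℕ × ℕ => Far ν x.1 x.2.1 x.2.2 := by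
  obtain ⟨f, hf, hd⟩ := hν.dist_computable
  have hz : Primrec fun y : (ℕ × ℕ × ℕ) × ℕ × ℕ => y.1.1 := fst.comp fst
  have hw : Primrec fun y : (ℕ × ℕ × ℕ) × ℕ × ℕ => y.1.2.1 := fst.comp (snd.comp fst)
  have ht : Primrec fun y : (ℕ × ℕ × ℕ) × ℕ × ℕ => y.1.2.2 := snd.comp (snd.comp fst)
  refine (rePred_exists (PrimrecPred.or (Primrec.eq.comp hw (const 0))
    (PrimrecRat.lt (((primrecRat_nuQPos.comp (primrec_radius.comp (pred.comp hw))).add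
      (primrecRat_nuQPos.comp (primrec_radius.comp hz))).add
        (primrecRat_half_pow.comp (fst.comp snd)))
      ((primrecRat_nuQ.comp (snd.comp snd)).add (primrecRat_one_div_succ.comp ht))))
    (computable_dist_approx hf)).of_eq fun x => ?_
  rw [Far, lt_add_iff_exists_approx (hd _ _), exists_or]
  simp only [exists_const]
  rfl

end Codes

theorem mem_openOf {ν : ℕ → X} {p : Baire} {x : X} :
    x ∈ openOf ν p ↔ ∃ n, p n ≠ 0 ∧ dist x (ν (p n - 1).unpair.1) < nuQPos (p n - 1).unpair.2 := by
  simp only [openOf, Opens.mem_iSup, exists_prop, Nat.one_le_iff_ne_zero]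
  rfl

theorem mem_idealBall {ν : ℕ → X} {z : ℕ} {x : X} :
    x ∈ idealBall ν z ↔ dist x (ν z.unpair.1) < nuQPos z.unpair.2 := Iff.rfl

/-- `Near` puts `x` deeper than `1 / (t' + 1)` inside the ball of `w`, whereas `Far` allows a depth
below `1 / (t + 1)` only, which is no larger. -/
theorem not_near_of_far {ν : ℕ → X} {x : X} {z z' w t t' : ℕ} (hx : x ∈ idealBall ν z)
    (hx' : x ∈ idealBall ν z') (htt : t' ≤ t) (hfar : Far ν z w t) : ¬ Near ν z' w t' := by
  rintro ⟨hw, hnear⟩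
  have hfar := hfar.resolve_left hw
  rw [mem_idealBall] at hx hx'
  have h1 := dist_triangle_left (ν z.unpair.1) (ν (w - 1).unpair.1) x
  have h2 := dist_triangle_right x (ν (w - 1).unpair.1) (ν z'.unpair.1)
  have h3 : 1 / ((t : ℝ) + 1) ≤ 1 / ((t' : ℝ) + 1) := by gcongr
  rw [dist_comm (ν (w - 1).unpair.1)] at h2
  linarith

/-! ### The realiser -/

/-- The finite word `u` witnesses that the ball coded by `z` may be listed in the name of the `i`-th
output set: it is far from all letters of the `i`-th name below stage `t`, and near to some letter
below stage `t` of all but at most `m k` of the `k` names. The relations `FR` and `NR` approximate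
`Far` and `Near`. -/
def Certificate (FR NR : ℕ → ℕ × ℕ × ℕ → Prop) (m : ℕ → ℕ) (u : List ℕ) (i z t : ℕ) : Prop :=
  open Classical in
  -- The length guard is essential: an unread position yields the default letter 0, for which `Far`
  -- holds trivially. `Near` rejects 0 and needs no guard.
  (∀ n < t, Nat.pair i n + 1 < u.length ∧ FR u.length (z, u.getD (Nat.pair i n + 1) 0, t)) ∧
    u.getD 0 0 ≤ ((Finset.range (u.getD 0 0)).filter fun j =>
      ∃ n < t, NR u.length (z, u.getD (Nat.pair j n + 1) 0, t)).card + m (u.getD 0 0)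

open Primrec in
theorem primrecPred_certificate {FR NR : ℕ → ℕ × ℕ × ℕ → Prop} {m : ℕ → ℕ}
    (hFR : PrimrecRel FR) (hNR : PrimrecRel NR) (hm : Primrec m) :
    PrimrecPred fun x : List ℕ × ℕ × ℕ × ℕ => Certificate FR NR m x.1 x.2.1 x.2.2.1 x.2.2.2 := by
  have getD {γ : Type} [Primcodable γ] {u : γ → List ℕ} {i n : γ → ℕ} (hu : Primrec u)
      (hi : Primrec i) (hn : Primrec n) :
      Primrec fun y => (u y).getD (Nat.pair (i y) (n y) + 1) 0 :=
    (list_getD 0).comp hu (succ.comp (Primrec₂.natPair.comp hi hn))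
  have hk : Primrec fun x : List ℕ × ℕ × ℕ × ℕ => x.1.getD 0 0 :=
    (list_getD 0).comp fst (const 0)
  have ht : Primrec fun x : List ℕ × ℕ × ℕ × ℕ => x.2.2.2 := snd.comp (snd.comp snd)
  have hz : Primrec fun x : List ℕ × ℕ × ℕ × ℕ => x.2.2.1 := fst.comp (snd.comp snd)
  have hi : Primrec fun x : List ℕ × ℕ × ℕ × ℕ => x.2.1 := fst.comp snd
  have hu : Primrec fun x : List ℕ × ℕ × ℕ × ℕ => x.1 := fst
  refine PrimrecPred.and (primrecPred_forall_lt
    (R := fun n x => Nat.pair x.2.1 n + 1 < x.1.length ∧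
      FR x.1.length (x.2.2.1, x.1.getD (Nat.pair x.2.1 n + 1) 0, x.2.2.2)) ?_ ht) ?_
  · exact PrimrecPred.and
      (nat_lt.comp (succ.comp (Primrec₂.natPair.comp (hi.comp snd) fst))
        (list_length.comp (hu.comp snd)))
      (hFR.comp (list_length.comp (hu.comp snd))
        ((hz.comp snd).pair ((getD (hu.comp snd) (hi.comp snd) fst).pair (ht.comp snd))))
  · refine nat_le.comp hk (nat_add.comp ?_ (hm.comp hk))
    classical
    convert primrec_card_filter_range (R := fun j (x : List ℕ × ℕ × ℕ × ℕ) => ∃ n < x.2.2.2,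
        NR x.1.length (x.2.2.1, x.1.getD (Nat.pair j n + 1) 0, x.2.2.2)) ?_ hk
    exact primrecPred_exists_lt (α := ℕ × List ℕ × ℕ × ℕ × ℕ) (R := fun n y =>
        NR y.2.1.length (y.2.2.2.1, y.2.1.getD (Nat.pair y.1 n + 1) 0, y.2.2.2.2))
      (hNR.comp (list_length.comp (hu.comp (snd.comp snd)))
        ((hz.comp (snd.comp snd)).pair ((getD (hu.comp (snd.comp snd)) (fst.comp snd) fst).pair
          (ht.comp (snd.comp snd))))) (ht.comp snd)

open Classical in
/-- The last letter written on the output tape after the word `u` has been read. -/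
noncomputable def outputLetter (C : List ℕ → ℕ → ℕ → ℕ → Prop) (u : List ℕ) : ℕ :=
  if u.length ≤ 1 then u.getD 0 0 else
    -- Tape position 0 copies `k`; position `⟨i, ⟨z, ⟨t, s⟩⟩⟩ + 1` is written after two more letters
    -- than the code, hence the `- 2`. The dummy `s` repeats the test on ever longer words.
    let c := (u.length - 2).unpair
    if C u c.1 c.2.unpair.1 c.2.unpair.2.unpair.1 then c.2.unpair.1 + 1 else 0

open Primrec in
theorem primrec_outputLetter {C : List ℕ → ℕ → ℕ → ℕ → Prop}
    (hC : PrimrecPred fun x : List ℕ × ℕ × ℕ × ℕ => C x.1 x.2.1 x.2.2.1 x.2.2.2) :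
    Primrec (outputLetter C) := by
  have hc : Primrec fun u : List ℕ => u.length - 2 := nat_sub.comp list_length (const 2)
  have hz := primrec_center.comp (primrec_radius.comp hc)
  classical
  exact Primrec.ite (nat_le.comp list_length (const 1)) ((list_getD 0).comp Primrec.id (const 0))
    (Primrec.ite (hC.comp (Primrec.id.pair ((primrec_center.comp hc).pair (hz.pair
      (primrec_center.comp (primrec_radius.comp (primrec_radius.comp hc)))))))
      (succ.comp hz) (const 0))

/-- The output on the tape when `p` is read. -/
noncomputable def output (C : List ℕ → ℕ → ℕ → ℕ → Prop) (p : Baire) : Baire :=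
  fun e => outputLetter C (initial p (e + 1))

theorem output_zero (C : List ℕ → ℕ → ℕ → ℕ → Prop) (p : Baire) : output C p 0 = p 0 := by
  simp [output, outputLetter, initial]

theorem mem_openOf_component_output {C : List ℕ → ℕ → ℕ → ℕ → Prop} {ν : ℕ → X} {p : Baire} {i : ℕ}
    {x : X} : x ∈ openOf ν (component (output C p) i) ↔ ∃ z t s, x ∈ idealBall ν z ∧
      C (initial p (Nat.pair i (Nat.pair z (Nat.pair t s)) + 2)) i z t := by
  classical
  have key : ∀ c, component (output C p) i c =
      if C (initial p (Nat.pair i c + 2)) i c.unpair.1 c.unpair.2.unpair.1 then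
        c.unpair.1 + 1 else 0 := by
    intro c
    simp [component, output, outputLetter]
  rw [mem_openOf]
  constructor
  · rintro ⟨c, hc, hx⟩
    rw [key] at hc hx
    split_ifs at hc hx with h
    · exact ⟨c.unpair.1, c.unpair.2.unpair.1, c.unpair.2.unpair.2, hx, by simpa using h⟩
    · simp at hc
  · rintro ⟨z, t, s, hx, h⟩
    refine ⟨Nat.pair z (Nat.pair t s), ?_⟩
    rw [key, if_pos (by simpa using h)]
    exact ⟨by simp, by simpa [mem_idealBall] using hx⟩

variable {ν : ℕ → X} {FR NR : ℕ → ℕ × ℕ × ℕ → Prop} {m : ℕ → ℕ}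

open Classical in
theorem exists_notMem_output (hFR : ∀ s y, FR s y → Far ν y.1 y.2.1 y.2.2)
    (hNR : ∀ s y, NR s y → Near ν y.1 y.2.1 y.2.2) (p : Baire) (x : X) {I : Finset ℕ}
    (hI : I ⊆ Finset.range (p 0)) (hmI : m (p 0) < I.card) :
    ∃ i ∈ I, x ∉ openOf ν (component (output (Certificate FR NR m) p) i) := by
  by_contra! H
  have H' : ∀ i, ∃ z t s, i ∈ I → x ∈ idealBall ν z ∧ 2 ≤ s ∧
      Certificate FR NR m (initial p s) i z t := by
    intro i
    by_cases hi : i ∈ I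
    · obtain ⟨z, t, s, hx, hC⟩ := mem_openOf_component_output.1 (H i hi)
      exact ⟨z, t, _, fun _ => ⟨hx, by omega, hC⟩⟩
    · exact ⟨0, 0, 0, fun h => absurd h hi⟩
  -- Compare the certificates through the one with least `t`: its `Near` indices must avoid `I`, so
  -- there are at most `p 0 - I.card` of them, too few for `hcard`.
  choose z t s hH using H'
  obtain ⟨i, hi, hmin⟩ := I.exists_min_image t (Finset.card_pos.1 (by omega))
  obtain ⟨hxi, hsi, -, hcard⟩ := hH i hi
  rw [getD_initial p (by omega)] at hcard
  have hsub : ((Finset.range (p 0)).filter fun j => ∃ n < t i, NR (initial p (s i)).length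
      (z i, (initial p (s i)).getD (Nat.pair j n + 1) 0, t i)) ⊆ Finset.range (p 0) \ I := by
    intro j hj
    obtain ⟨hjk, n, hn, hnear⟩ := Finset.mem_filter.1 hj
    refine Finset.mem_sdiff.2 ⟨hjk, fun hjI => ?_⟩
    obtain ⟨hxj, -, hfar, -⟩ := hH j hjI
    obtain ⟨hlt, hfar⟩ := hfar n (hn.trans_le (hmin j hjI))
    have hnear := hNR _ _ hnear
    have hfar := hFR _ _ hfar
    rw [getD_initial p (by simpa using hlt)] at hfar
    rcases lt_or_ge (Nat.pair j n + 1) (s i) with h | h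
    · rw [getD_initial p h] at hnear
      exact not_near_of_far hxj hxi (hmin j hjI) hfar hnear
    · rw [getD_initial_of_le p h] at hnear
      exact hnear.1 rfl
  have h1 := Finset.card_le_card hsub
  rw [Finset.card_sdiff_of_subset hI, Finset.card_range] at h1
  have h2 := Finset.card_le_card hI
  rw [Finset.card_range] at h2
  omega

theorem nuQPos_pair_zero (n : ℕ) : (nuQPos (Nat.pair 0 n) : ℝ) = 1 / ((n : ℝ) + 1) := by
  simp [nuQPos]

open Classical in
theorem mem_output (hν : DenseRange ν) (hFR : ∀ z w t, Far ν z w t → ∀ᶠ s in atTop, FR s (z, w, t))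
    (hNR : ∀ z w t, Near ν z w t → ∀ᶠ s in atTop, NR s (z, w, t)) (p : Baire) {x : X} {i : ℕ}
    (hi : x ∉ openOf ν (component p i))
    (hk : p 0 ≤ ((Finset.range (p 0)).filter fun j => x ∈ openOf ν (component p j)).card +
      m (p 0)) :
    x ∈ openOf ν (component (output (Certificate FR NR m) p) i) := by
  have hlim : Tendsto (fun t : ℕ => 2 * (1 / ((t : ℝ) + 1))) atTop (nhds 0) := by
    simpa using tendsto_one_div_add_atTop_nhds_zero_nat.const_mul (2 : ℝ)
  have hev : ∀ᶠ t : ℕ in atTop, ∀ j ∈ Finset.range (p 0), x ∈ openOf ν (component p j) →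
      ∃ n < t, component p j n ≠ 0 ∧ dist x (ν (component p j n - 1).unpair.1) +
        2 * (1 / ((t : ℝ) + 1)) < nuQPos (component p j n - 1).unpair.2 := by
    rw [Filter.eventually_all_finset]
    intro j _
    by_cases hj : x ∈ openOf ν (component p j)
    · obtain ⟨n, hn, hd⟩ := mem_openOf.1 hj
      filter_upwards [eventually_gt_atTop n, hlim.eventually_lt_const (sub_pos.2 hd)] with t h1 h2 _
      exact ⟨n, h1, hn, by linarith⟩
    · exact Eventually.of_forall fun t h => absurd h hj
  -- At this `t`, every `U j` containing `x` shows it among its first `t` letters with depth above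
  -- `2 / (t + 1)`: one half is the margin of `Near`, the other absorbs the size of the new ball.
  obtain ⟨t, ht⟩ := hev.exists
  obtain ⟨a, ha⟩ := hν.exists_dist_lt x
    (show (0 : ℝ) < 1 / (((2 * t + 2 : ℕ) : ℝ) + 1) by positivity)
  -- Radius `1 / (2 * t + 3)`: twice it is below `1 / (t + 1)`, which pays for both the radius and
  -- the distance from `x` to the centre.
  set z := Nat.pair a (Nat.pair 0 (2 * t + 2)) with hz
  have hz1 : z.unpair.1 = a := by simp [hz]
  have hz2 : (nuQPos z.unpair.2 : ℝ) = 1 / (((2 * t + 2 : ℕ) : ℝ) + 1) := by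
    rw [hz, Nat.unpair_pair, nuQPos_pair_zero]
  have hxz : x ∈ idealBall ν z := by
    rw [mem_idealBall, hz1, hz2]
    exact ha
  have hρ : 2 * (1 / (((2 * t + 2 : ℕ) : ℝ) + 1)) < 1 / ((t : ℝ) + 1) := by
    rw [mul_one_div, div_lt_div_iff₀ (by positivity) (by positivity)]
    push_cast
    linarith
  have hfar : ∀ n, Far ν z (component p i n) t := by
    intro n
    rw [Far, or_iff_not_imp_left, hz1, hz2]
    intro hn
    have h1 : (nuQPos (component p i n - 1).unpair.2 : ℝ) ≤
        dist x (ν (component p i n - 1).unpair.1) := by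
      by_contra! h
      exact hi (mem_openOf.2 ⟨n, hn, h⟩)
    have h2 := dist_triangle x (ν a) (ν (component p i n - 1).unpair.1)
    linarith
  have hnear : ∀ j ∈ Finset.range (p 0), x ∈ openOf ν (component p j) →
      ∃ n < t, Near ν z (component p j n) t := by
    intro j hj hxj
    obtain ⟨n, hn, h0, h1⟩ := ht j hj hxj
    refine ⟨n, hn, h0, ?_⟩
    rw [hz1, hz2]
    have h2 := dist_triangle_left (ν a) (ν (component p j n - 1).unpair.1) x
    linarith
  have hF : ∀ᶠ s in atTop, ∀ n ∈ Finset.range t,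
      Nat.pair i n + 1 < s ∧ FR s (z, component p i n, t) := by
    rw [Filter.eventually_all_finset]
    exact fun n _ => (eventually_gt_atTop _).and (hFR _ _ _ (hfar n))
  have hN : ∀ᶠ s in atTop, ∀ j ∈ Finset.range (p 0), x ∈ openOf ν (component p j) →
      ∃ n < t, Nat.pair j n + 1 < s ∧ NR s (z, component p j n, t) := by
    rw [Filter.eventually_all_finset]
    intro j hj
    by_cases hxj : x ∈ openOf ν (component p j)
    · obtain ⟨n, hn, h⟩ := hnear j hj hxj
      filter_upwards [eventually_gt_atTop (Nat.pair j n + 1), hNR _ _ _ h] with s h1 h2 _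
      exact ⟨n, hn, h1, h2⟩
    · exact Eventually.of_forall fun t h => absurd h hxj
  obtain ⟨s₀, hs₀⟩ := eventually_atTop.1 (hF.and hN)
  refine mem_openOf_component_output.2 ⟨z, t, s₀, hxz, ?_⟩
  -- Choosing the dummy component `s₀` makes the word read here at least `s₀` long.
  set s := Nat.pair i (Nat.pair z (Nat.pair t s₀)) + 2 with hs
  have hle : s₀ ≤ s := by
    have h1 := Nat.right_le_pair t s₀
    have h2 := Nat.right_le_pair z (Nat.pair t s₀)
    have h3 := Nat.right_le_pair i (Nat.pair z (Nat.pair t s₀))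
    omega
  obtain ⟨hF, hN⟩ := hs₀ s hle
  refine ⟨fun n hn => ?_, ?_⟩
  · obtain ⟨h1, h2⟩ := hF n (Finset.mem_range.2 hn)
    rw [length_initial, getD_initial p h1]
    exact ⟨h1, h2⟩
  · rw [getD_initial p (show 0 < s by omega)]
    refine hk.trans (Nat.add_le_add_right (Finset.card_le_card fun j hj => ?_) _)
    obtain ⟨hjk, hxj⟩ := Finset.mem_filter.1 hj
    obtain ⟨n, hn, h1, h2⟩ := hN j hjk hxj
    refine Finset.mem_filter.2 ⟨hjk, n, hn, ?_⟩
    rw [length_initial, getD_initial p h1]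
    exact h2

open Classical in
/-- There is a computable functional that turns names of open sets `U i`, `i < k`, into names of
open sets `V i`, `i < k`, such that no point belongs to more than `m k` of the sets `V i`, and a
point outside of `U i` belongs to `V i` if it lies outside of at most `m k` of the sets `U j`. -/
theorem exists_computableFun_complementary (hν : IsComputableMetricSpace ν) (hm : Primrec m) :
    ∃ Q : Baire → Baire, ComputableFun (fun p => Part.some (Q p)) ∧ ∀ p, Q p 0 = p 0 ∧
      (∀ x i, x ∉ openOf ν (component p i) →
        p 0 ≤ ((Finset.range (p 0)).filter fun j => x ∈ openOf ν (component p j)).card + m (p 0) →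
        x ∈ openOf ν (component (Q p) i)) ∧
      ∀ x, ∀ I ⊆ Finset.range (p 0), m (p 0) < I.card →
        ∃ i ∈ I, x ∉ openOf ν (component (Q p) i) := by
  obtain ⟨FR, hFR, hFs, hFc⟩ := exists_primrecRel_of_rePred (rePred_far hν)
  obtain ⟨NR, hNR, hNs, hNc⟩ := exists_primrecRel_of_rePred (rePred_near hν)
  refine ⟨output (Certificate FR NR m), computableFun_of_primrec
    (primrec_outputLetter (primrecPred_certificate hFR hNR hm)), fun p => ⟨output_zero _ p, ?_, ?_⟩⟩
  · exact fun x i => mem_output hν.dense (fun z w t => hFc (z, w, t)) (fun z w t => hNc (z, w, t)) p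
  · exact fun x I hI => exists_notMem_output hFs hNs p x hI

/-! ### The three operations -/

/-- The output length `Q p 0` equals `p 0` only propositionally, so words need transport. -/
theorem word_ext {A : Type*} {k l : ℕ} (h : l = k) (G : ℕ → A) :
    (⟨l, fun i => G i⟩ : Word A) = ⟨k, fun i => G i⟩ := by
  subst h
  rfl

theorem mem_starRep_some {A : Type*} {δ : Baire → A} {p : Baire} {a : Word A} :
    a ∈ starRep (fun q => Part.some (δ q)) p ↔ a = ⟨p 0, fun i => δ (component p i)⟩ := by
  constructor
  · rintro ⟨_, rfl⟩
    rfl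
  · rintro rfl
    exact ⟨fun _ => trivial, rfl⟩

/-- A criterion for the computability of operations between words of sets that preserve the
length. -/
theorem isComputable_of_total {A B : Type*} {δ : Baire → A} {δ' : Baire → B}
    {f : MultiMap (Word A) (Word B)} {Q : Baire → Baire}
    (hQ : ComputableFun fun p => Part.some (Q p)) (h0 : ∀ p, Q p 0 = p 0)
    (h : ∀ p, (⟨p 0, fun i => δ (component p i)⟩ : Word A) ∈ f.dom →
      (⟨p 0, fun i => δ' (component (Q p) i)⟩ : Word B) ∈
        f.val ⟨p 0, fun i => δ (component p i)⟩) :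
    f.IsComputable (starRep fun q => Part.some (δ q)) (starRep fun q => Part.some (δ' q)) := by
  refine ⟨_, hQ, fun p a ha hdom => ?_⟩
  obtain rfl := mem_starRep_some.1 ha
  refine ⟨Q p, Part.mem_some _, _, mem_starRep_some.2 rfl, ?_⟩
  rw [word_ext (h0 p) fun i => δ' (component (Q p) i)]
  exact h p hdom

theorem order_le_iff {Y ι : Type*} {A : ι → Set Y} {n : ℕ} :
    order A ≤ n ↔ ∀ s : Finset ι, n < s.card → ⋂ i ∈ s, A i = ∅ := by
  constructor
  · intro h s hs
    -- Passing to a strict bound extracts an actual member `l ≤ n` from the infimum; `l + 1` indices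
    -- of `s` then suffice.
    have hlt : order A < ((n + 1 : ℕ) : ℕ∞) := h.trans_lt (by exact_mod_cast n.lt_succ_self)
    obtain ⟨_, ⟨l, hl, rfl⟩, hln⟩ := sInf_lt_iff.1 hlt
    have hln : l + 1 ≤ s.card := by
      have : l < n + 1 := Nat.cast_lt.1 (hln : (l : ℕ∞) < ((n + 1 : ℕ) : ℕ∞))
      omega
    obtain ⟨u, hu, hcard⟩ := Finset.exists_subset_card_eq hln
    have e := u.equivFinOfCardEq hcard
    refine Set.eq_empty_of_subset_empty ?_
    rw [← hl (fun j => (e.symm j : ι)) (Subtype.val_injective.comp e.symm.injective)]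
    exact Set.subset_iInter fun j => Set.biInter_subset_of_mem (hu (e.symm j).2)
  · intro h
    refine sInf_le ⟨n, fun i hi => ?_, rfl⟩
    have := h (Finset.univ.map ⟨i, hi⟩) (by simp)
    simpa using this

/-! ### Counting memberships in finite families -/

section Operations

variable {k : ℕ} {U V : ℕ → Opens X} {μ : ℕ}

/-- Apply `h` to all `k` indices. For `k = 0` the intersection is the whole space, so `hk` is
needed. -/
theorem iInter_eq_empty_of_forall_exists_notMem (hk : k ≠ 0)
    (h : ∀ x, ∀ I ⊆ Finset.range k, k - 1 < I.card → ∃ i ∈ I, x ∉ V i) :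
    ⋂ i : Fin k, (V i : Set X) = ∅ := by
  refine Set.eq_empty_of_forall_notMem fun x hx => ?_
  obtain ⟨i, hi, hxi⟩ := h x _ subset_rfl (by rw [Finset.card_range]; omega)
  exact hxi (Set.mem_iInter.1 hx ⟨i, Finset.mem_range.1 hi⟩)

open Classical in
theorem le_card_add_pred_of_iUnion_eq_univ (h : ⋃ i : Fin k, (U i : Set X) = univ) (x : X) :
    k ≤ ((Finset.range k).filter fun j => x ∈ U j).card + (k - 1) := by
  obtain ⟨i, hi⟩ := Set.mem_iUnion.1 (h.ge (mem_univ x))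
  have : 0 < ((Finset.range k).filter fun j => x ∈ U j).card :=
    Finset.card_pos.2 ⟨i, Finset.mem_filter.2 ⟨Finset.mem_range.2 i.2, hi⟩⟩
  omega

open Classical in
theorem le_card_add_of_order_compl_le (h : order (fun i : Fin k => (U i : Set X)ᶜ) ≤ μ) (x : X) :
    k ≤ ((Finset.range k).filter fun j => x ∈ U j).card + μ := by
  by_contra! hlt
  -- If the bound failed, more than `μ` of the complements would contain `x`.
  have hcard : ((Finset.range k).filter fun j => x ∈ U j).card +
      (Finset.univ.filter fun i : Fin k => x ∉ U i).card = k := by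
    rw [Finset.card_filter (fun i : Fin k => x ∉ U i),
      Fin.sum_univ_eq_sum_range (fun i => if x ∉ U i then 1 else 0), ← Finset.card_filter,
      Finset.card_filter_add_card_filter_not, Finset.card_range]
  have := order_le_iff.1 h (Finset.univ.filter fun i : Fin k => x ∉ U i) (by omega)
  refine this.le (show x ∈ _ from ?_)
  simp

theorem order_le_of_forall_exists_notMem
    (h : ∀ x, ∀ I ⊆ Finset.range k, μ < I.card → ∃ i ∈ I, x ∉ V i) :
    order (fun i : Fin k => (V i : Set X)) ≤ μ := by
  refine order_le_iff.2 fun s hs => Set.eq_empty_of_forall_notMem fun x hx => ?_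
  obtain ⟨i, hi, hxi⟩ := h x (s.map Fin.valEmbedding)
    (fun i hi => by obtain ⟨j, -, rfl⟩ := Finset.mem_map.1 hi; simp) (by simpa using hs)
  obtain ⟨j, hj, rfl⟩ := Finset.mem_map.1 hi
  exact hxi (Set.mem_iInter₂.1 hx j hj)

end Operations

end Metric

end TTE

open TTE in
theorem proposition3p4 {X : Type*} [MetricSpace X] (ν : ℕ → X)
    (hν : TTE.IsComputableMetricSpace ν) :
    (TTE.closedShrinking X).IsComputable
        (TTE.starRep (TTE.deltaSigma ν)) (TTE.starRep (TTE.deltaPi ν)) ∧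
      (TTE.openSwelling X).IsComputable
        (TTE.starRep (TTE.deltaPi ν)) (TTE.starRep (TTE.deltaSigma ν)) ∧
      ∀ N : ℕ, (TTE.openSwellingOfOrder X N).IsComputable
        (TTE.starRep (TTE.deltaPi ν)) (TTE.starRep (TTE.deltaSigma ν)) := by
  -- With `m k = k - 1`, no point lies in every `V i`, and lying in one `U j` is enough.
  obtain ⟨Q, hQ, hQp⟩ := exists_computableFun_complementary hν Primrec.pred
  have hclosed : ∀ p : Baire, ⋂ i : Fin (p 0), ((openOf ν (component p i)).compl : Set X) = ∅ →
      ⋃ i : Fin (p 0), (openOf ν (component p i) : Set X) = univ := by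
    intro p h
    rw [← compl_empty_iff, compl_iUnion]
    exact h
  have hne : ∀ p : Baire, ⋃ i : Fin (p 0), (openOf ν (component p i) : Set X) = univ → p 0 ≠ 0 := by
    intro p h h0
    -- The point `ν 0` shows that `X` is nonempty, so the empty family is not a cover.
    obtain ⟨i, -⟩ := mem_iUnion.1 (h.ge (mem_univ (ν 0)))
    exact absurd i.2 (by omega)
  have hcover : ∀ p : Baire, ⋃ i : Fin (p 0), (openOf ν (component p i) : Set X) = univ →
      ⋂ i : Fin (p 0), (openOf ν (component (Q p) i) : Set X) = ∅ ∧
      ∀ i x, x ∉ openOf ν (component p i) → x ∈ openOf ν (component (Q p) i) := fun p h =>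
    ⟨iInter_eq_empty_of_forall_exists_notMem (V := fun i => openOf ν (component (Q p) i)) (hne p h)
      (hQp p).2.2, fun i x hx => (hQp p).2.1 x i hx (le_card_add_pred_of_iUnion_eq_univ
        (U := fun i => openOf ν (component p i)) h x)⟩
  refine ⟨isComputable_of_total hQ (fun p => (hQp p).1) fun p hp => ?_,
    isComputable_of_total hQ (fun p => (hQp p).1) fun p hp => ?_, fun N => ?_⟩
  · obtain ⟨h1, h2⟩ := hcover p hp
    refine ⟨_, ⟨fun i x hx => ?_, ?_⟩, rfl⟩
    · by_contra h
      exact hx (h2 i x h)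
    · rw [← compl_empty_iff, compl_iUnion]
      simpa using h1
  · obtain ⟨h1, h2⟩ := hcover p (hclosed p hp)
    exact ⟨_, ⟨h1, fun i x hx => h2 i x hx⟩, rfl⟩
  · obtain ⟨Q, hQ, hQp⟩ := exists_computableFun_complementary hν (Primrec.const (N + 1))
    refine isComputable_of_total hQ (fun p => (hQp p).1) fun p hp =>
      ⟨_, ⟨fun i x hx => (hQp p).2.1 x i hx ?_, ?_⟩, rfl⟩
    · exact le_card_add_of_order_compl_le (U := fun i => openOf ν (component p i))
        (by exact_mod_cast hp) x
    · exact_mod_cast order_le_of_forall_exists_notMem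
        (V := fun i => openOf ν (component (Q p) i)) (hQp p).2.2
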